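/- Let $p$ be a prime, let $\mathbb{F}_{p^m}$ be a finite field with $p^m$ elements, and let $n\ge 1$ and $s\ge 0$ be integers such that $N:=np^s\ge 2$. Let $\alpha_0\in\mathbb{F}_{p^m}$ be nonzero and put $\alpha=\alpha_0^{p^s}$. Identify a word $(c_0,\dots,c_{N-1})\in\mathbb{F}_{p^m}^N$ with the class of $c_0+c_1x+\cdots+c_{N-1}x^{N-1}$ in $\mathcal{F}=\mathbb{F}_{p^m}[x]/\langle x^{N}-\alpha\rangle$, and for $0\le i\le p^s$ let $\mathcal{C}_i=\langle (x^n-\alpha_0)^i\rangle\subseteq\mathcal{F}$, an $\alpha$-constacyclic code of length $N$. The symbol-pair distance of two words $\boldsymbol{x},\boldsymbol{y}$ of length $N$ is the number of indices $j$ modulo $N$ with $(x_j,x_{j+1})\ne(y_j,y_{j+1})$, and the symbol-pair distance $\operatorname{d_{sp}}(\mathcal{C})$ of a code $\mathcal{C}$ is the minimum of the symbol-pair distances of two distinct codewords, with the convention $\operatorname{d_{sp}}(\{0\})=0$. Then $\operatorname{d_{sp}}(\mathcal{C}_i)$ is completely determined as follows ($i,k,\theta$ denote integers). (i) $\operatorname{d_{sp}}(\mathcal{C}_0)=2$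 and $\operatorname{d_{sp}}(\mathcal{C}_{p^s})=0$. (ii) If $n=1$, then $$\operatorname{d_{sp}}(\mathcal{C}_{i})=\begin{cases} 3p^k, & \text{if } i=p^s-p^{s-k}+1 \text{ and } 0\le k\le s-2;\\ 4p^k, & \text{if } p^{s}-p^{s-k}+2\le i\le p^{s}-p^{s-k}+p^{s-k-1} \text{ and } 0\le k\le s-2;\\ 2(\theta+2)p^{k}, & \text{if } p^s-p^{s-k}+\theta p^{s-k-1}+1\le i\le p^s-p^{s-k}+(\theta+1)p^{s-k-1},\\ & \quad 0\le k\le s-2 \text{ and } 1\le\theta\le p-2;\\ (\theta+2)p^{s-1}, & \text{if } i=p^s-p+\theta \text{ and } 1\le\theta\le p-2;\\ p^s, & \text{if } i=p^s-1, \end{cases}$$ and every $i$ with $1\le i\le p^s-1$ falls under one of these cases. (iii) If $n\ge 2$, then $\operatorname{d_{sp}}(\mathcal{C}_i)=2(\theta+2)p^{k}$ whenever $p^s-p^{s-k}+\theta p^{s-k-1}+1\le i\le p^s-p^{s-k}+(\theta+1)p^{s-k-1}$, $0\le k\le s-1$ and $0\le\theta\le p-2$; and every $i$ with $1\le i\le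 p^s-1$ satisfies these inequalities for some such $k,\theta$. -/

import Mathlib

open Polynomial

namespace SymbolPair

/-- The symbol-pair vector `π(x) = ((x₀, x₁), (x₁, x₂), …, (x_{N-1}, x₀))` of a word `x` of
length `N`; `finRotate N` is the cyclic successor `j ↦ j + 1 (mod N)`. -/
def pairVector {Ξ : Type*} {N : ℕ} (x : Fin N → Ξ) : Fin N → Ξ × Ξ :=
  fun j => (x j, x (finRotate N j))

/-- The symbol-pair distance of two words: the Hamming distance of their symbol-pair vectors. -/
def pairDist {Ξ : Type*} [DecidableEq Ξ] {N : ℕ} (x y : Fin N → Ξ) : ℕ :=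
  hammingDist (pairVector x) (pairVector y)

/-- The (minimum) symbol-pair distance of a code. A code with at most one codeword has
symbol-pair distance `0` (this is the value of `sInf ∅` in `ℕ`). -/
noncomputable def minPairDist {Ξ : Type*} [DecidableEq Ξ] {N : ℕ} (𝒞 : Set (Fin N → Ξ)) : ℕ :=
  sInf {d : ℕ | ∃ x ∈ 𝒞, ∃ y ∈ 𝒞, x ≠ y ∧ d = pairDist x y}

/-- The residue ring `F[x] / ⟨x ^ N - α⟩`. -/
abbrev ConstaRing {F : Type*} [Field F] (N : ℕ) (α : F) : Type _ :=
  AdjoinRoot (X ^ N - C α : F[X])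

/-- The polynomial representation `c₀ + c₁ x + ⋯ + c_{N-1} x ^ (N-1)` in `F[x] / ⟨x ^ N - α⟩`
of a word `(c₀, …, c_{N-1})`. -/
noncomputable def polyRep {F : Type*} [Field F] (N : ℕ) (α : F) :
    (Fin N → F) →ₗ[F] ConstaRing N α :=
  Fintype.linearCombination F
    (fun j : Fin N => AdjoinRoot.root (X ^ N - C α : F[X]) ^ (j : ℕ))

/-- The `α`-constacyclic code of length `N` given by an ideal of `F[x] / ⟨x ^ N - α⟩`: all words
whose polynomial representation lies in the ideal. -/
noncomputable def codeOfIdeal {F : Type*} [Field F] (N : ℕ) (α : F)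
    (I : Ideal (ConstaRing N α)) : Submodule F (Fin N → F) :=
  (I.restrictScalars F).comap (polyRep N α)

/-- The code `⟨(x ^ n - α₀) ^ i⟩` of length `N` in `F[x] / ⟨x ^ N - α⟩`. -/
noncomputable def binomialCode {F : Type*} [Field F] (N : ℕ) (α : F) (n : ℕ) (α₀ : F) (i : ℕ) :
    Submodule F (Fin N → F) :=
  codeOfIdeal N α
    (Ideal.span {AdjoinRoot.mk (X ^ N - C α : F[X]) ((X ^ n - C α₀) ^ i)})

end SymbolPair

/-! By linearity the task is to find the least pair weight of a nonzero codeword. Since `(X^n -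
α₀)^i` divides the modulus, codewords are exactly its polynomial multiples of degree below `N`.

Reduction to short length: write `i = p^s - p^w + i'` and `s = k + w`. By Frobenius, `(X^n -
α₀)^(p^s - p^w)` is a geometric sum in `X^(n p^w)` with `p^k` terms. Multiplying it by `G` of degree
below `n p^w` lays down `p^k` nonzero multiples of `G` end to end, so the pair weight is `p^k` times
the cyclic pair weight of `G` in length `n p^w`. It remains to treat multiples of `(X^n - α₀)^i'` in
that length, with `w = u + 1` and `θ p^u < i' ≤ (θ+1) p^u` (outside the length-`p` case).

Upper bounds: `(X^n - α₀)^((θ+1) p^u)` has at most `θ + 2` terms, and each term meets two pairs. For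
`n = 1` the short words `X - α₀` and, in length `p`, `(X - α₀)^θ` do better, because their supports
lie in an interval.

Lower bounds: sort exponents by residue modulo a divisor `D ≥ 2` of the length. If one class is
occupied, no two exponents are adjacent and the pair weight is twice the Hamming weight; if several
are, the Hamming weights of the classes add up. The operator `X d/dX - r` removes terms at the cost
of one root multiplicity, which bounds the Hamming weights (`add_two_le_card_support`). -/

namespace SymbolPair

/-! ### Combinatorics of cyclic pair supports. -/

/-- The positions `j < N` such that `j` or its cyclic successor lies in `S`. -/
def pairSupport (N : ℕ) (S : Finset ℕ) : Finset ℕ :=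
  {j ∈ Finset.range N | j ∈ S ∨ (j + 1) % N ∈ S}

theorem card_pairSupport_le (N : ℕ) (S : Finset ℕ) : (pairSupport N S).card ≤ N :=
  (Finset.card_filter_le _ _).trans (Finset.card_range N).le

theorem subset_pairSupport {N : ℕ} {S : Finset ℕ} (hS : S ⊆ Finset.range N) :
    S ⊆ pairSupport N S := fun _ ha => Finset.mem_filter.2 ⟨hS ha, Or.inl ha⟩

theorem card_le_card_pairSupport {N : ℕ} {S : Finset ℕ} (hS : S ⊆ Finset.range N) :
    S.card ≤ (pairSupport N S).card :=
  Finset.card_le_card (subset_pairSupport hS)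

theorem eq_pred_mod {N j : ℕ} (hj : j < N) : ((j + 1) % N + N - 1) % N = j := by
  rcases Nat.lt_or_ge (j + 1) N with h | h
  · rw [Nat.mod_eq_of_lt h, show j + 1 + N - 1 = j + N by omega, Nat.add_mod_right,
      Nat.mod_eq_of_lt hj]
  · have h1 : N = j + 1 := by omega
    subst h1
    rw [Nat.mod_self, show 0 + (j + 1) - 1 = j by omega, Nat.mod_eq_of_lt hj]

theorem succ_pred_mod {N a : ℕ} (ha : a < N) : ((a + N - 1) % N + 1) % N = a := by
  rw [Nat.mod_add_mod, show a + N - 1 + 1 = a + N by omega, Nat.add_mod_right,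
    Nat.mod_eq_of_lt ha]

theorem card_pairSupport_le_two_mul (N : ℕ) (S : Finset ℕ) :
    (pairSupport N S).card ≤ 2 * S.card := by
  have h : pairSupport N S ⊆ S ∪ S.image (fun a => (a + N - 1) % N) := by
    intro j hj
    obtain ⟨h1, h2⟩ := Finset.mem_filter.1 hj
    rcases h2 with h2 | h2
    · exact Finset.mem_union_left _ h2
    · exact Finset.mem_union_right _
        (Finset.mem_image.2 ⟨_, h2, eq_pred_mod (Finset.mem_range.1 h1)⟩)
  have h1 := Finset.card_le_card h
  have h2 := Finset.card_union_le S (S.image (fun a => (a + N - 1) % N))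
  have h3 := Finset.card_image_le (s := S) (f := fun a => (a + N - 1) % N)
  omega

theorem card_pairSupport_le_of_subset_range {N t : ℕ} {S : Finset ℕ}
    (hS : S ⊆ Finset.range (t + 1)) : (pairSupport N S).card ≤ t + 2 := by
  have h : pairSupport N S ⊆ insert (N - 1) (Finset.range (t + 1)) := by
    intro j hj
    obtain ⟨h1, h2⟩ := Finset.mem_filter.1 hj
    rw [Finset.mem_range] at h1
    rw [Finset.mem_insert]
    rcases h2 with h2 | h2
    · exact Or.inr (hS h2)
    · rcases Nat.lt_or_ge (j + 1) N with h | h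
      · rw [Nat.mod_eq_of_lt h] at h2
        have := Finset.mem_range.1 (hS h2)
        right; rw [Finset.mem_range]; omega
      · left; omega
  have h1 := Finset.card_le_card h
  have h2 := Finset.card_insert_le (N - 1) (Finset.range (t + 1))
  rw [Finset.card_range] at h2
  omega

/-- Elements of `S` whose cyclic predecessor is not in `S` contribute one more position. -/
theorem card_add_card_le_card_pairSupport {N : ℕ} {S T : Finset ℕ} (hS : S ⊆ Finset.range N)
    (hTS : T ⊆ S) (hT : ∀ j < N, (j + 1) % N ∈ T → j ∉ S) :
    S.card + T.card ≤ (pairSupport N S).card := by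
  have hlt : ∀ a ∈ T, a < N := fun a ha => Finset.mem_range.1 (hS (hTS ha))
  have hinj : Set.InjOn (fun a => (a + N - 1) % N) T := by
    intro a ha b hb hab
    rw [← succ_pred_mod (hlt a ha), ← succ_pred_mod (hlt b hb)]
    simp only at hab
    rw [hab]
  have hmod : ∀ a ∈ T, (a + N - 1) % N < N := fun a ha =>
    Nat.mod_lt _ (lt_of_le_of_lt (Nat.zero_le a) (hlt a ha))
  rw [← Finset.card_image_of_injOn hinj, ← Finset.card_union_of_disjoint]
  · apply Finset.card_le_card
    apply Finset.union_subset (subset_pairSupport hS)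
    intro j hj
    obtain ⟨a, ha, rfl⟩ := Finset.mem_image.1 hj
    refine Finset.mem_filter.2 ⟨Finset.mem_range.2 (hmod a ha), Or.inr ?_⟩
    rw [succ_pred_mod (hlt a ha)]
    exact hTS ha
  · rw [Finset.disjoint_right]
    intro j hj
    obtain ⟨a, ha, rfl⟩ := Finset.mem_image.1 hj
    refine hT _ (hmod a ha) ?_
    rw [succ_pred_mod (hlt a ha)]
    exact ha

theorem of_succ_imp {Q : ℕ → Prop} (h : ∀ m, Q (m + 1) → Q m) {a b : ℕ} (hab : a ≤ b)
    (hb : Q b) : Q a := by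
  induction b, hab using Nat.le_induction with
  | base => exact hb
  | succ m _ ih => exact ih (h m hb)

/-- A proper nonempty set of residues has an element whose predecessor lies outside. -/
theorem exists_mod_notMem_succ_mod_mem {q : ℕ} {R : Finset ℕ} (hne : R.Nonempty)
    (hR : R ⊆ Finset.range q) (hcard : R.card < q) : ∃ m, m % q ∉ R ∧ (m + 1) % q ∈ R := by
  by_contra! hcon
  obtain ⟨a, ha⟩ := hne
  have hall : Finset.range q ⊆ R := by
    intro b hb
    rw [Finset.mem_range] at hb
    -- Membership descends from `a + q`, a representative of `a` above every `b < q`.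
    have : b % q ∈ R := of_succ_imp (Q := fun m => m % q ∈ R)
      (fun m hm => by by_contra h; exact hcon m h hm) (show b ≤ a + q by omega)
      (by rw [Nat.add_mod_right, Nat.mod_eq_of_lt (Finset.mem_range.1 (hR ha))]; exact ha)
    rwa [Nat.mod_eq_of_lt hb] at this
  have := Finset.card_le_card hall
  rw [Finset.card_range] at this
  omega

theorem card_lt_card_pairSupport {N : ℕ} {S : Finset ℕ} (hS : S ⊆ Finset.range N)
    (hne : S.Nonempty) (hcard : S.card < N) : S.card + 1 ≤ (pairSupport N S).card := by
  obtain ⟨m, hm, hm'⟩ := exists_mod_notMem_succ_mod_mem hne hS hcard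
  have := card_add_card_le_card_pairSupport hS (T := {(m + 1) % N})
    (Finset.singleton_subset_iff.2 hm') (fun j hj h => by
      rw [Finset.mem_singleton] at h
      have h1 : j ≡ m [MOD N] := Nat.ModEq.add_right_cancel' 1 h
      rw [← Nat.mod_eq_of_lt hj, h1]
      exact hm)
  simpa using this

/-- A proper nonempty support gains at least one position. A full one gains none, whence the
condition `v + 1 ≤ N`. -/
theorem min_le_card_pairSupport {N v : ℕ} {S : Finset ℕ} (hS : S ⊆ Finset.range N)
    (hne : S.Nonempty) (hN : v + 1 ≤ N) (hv : v ≤ S.card) :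
    v + 1 ≤ (pairSupport N S).card := by
  rcases Nat.lt_or_ge S.card N with h | h
  · have := card_lt_card_pairSupport hS hne h
    omega
  · have := card_le_card_pairSupport hS
    omega

/-- A residue class modulo `D` which is preceded by an empty class consists of elements
without predecessor. -/
theorem card_add_card_class_le {N D m : ℕ} {S : Finset ℕ} (hS : S ⊆ Finset.range N)
    (hD : D ∣ N) (hm : m % D ∉ S.image (· % D)) :
    S.card + ({a ∈ S | a % D = (m + 1) % D} : Finset ℕ).card ≤ (pairSupport N S).card := by
  refine card_add_card_le_card_pairSupport hS (Finset.filter_subset _ _) ?_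
  intro j _ h hjS
  have h1 := (Finset.mem_filter.1 h).2
  rw [Nat.mod_mod_of_dvd _ hD] at h1
  have h2 : j ≡ m [MOD D] := Nat.ModEq.add_right_cancel' 1 h1
  exact hm (Finset.mem_image.2 ⟨j, hjS, h2⟩)

/-- As `D ∣ N`, residues modulo `D` survive the cyclic wrap, so elements of a single class are never
adjacent. -/
theorem two_mul_card_le_card_pairSupport {N D : ℕ} {S : Finset ℕ} (hS : S ⊆ Finset.range N)
    (hD : D ∣ N) (hD2 : 2 ≤ D) (hcl : (S.image (· % D)).card = 1) :
    2 * S.card ≤ (pairSupport N S).card := by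
  obtain ⟨r, hr⟩ := Finset.card_eq_one.1 hcl
  have hmem : ∀ a ∈ S, a % D = r := fun a ha => by
    simpa [hr] using Finset.mem_image_of_mem (· % D) ha
  have hRD : S.image (· % D) ⊆ Finset.range D := by
    intro a ha
    obtain ⟨b, _, rfl⟩ := Finset.mem_image.1 ha
    exact Finset.mem_range.2 (Nat.mod_lt _ (by omega))
  obtain ⟨m, hm, hm'⟩ := exists_mod_notMem_succ_mod_mem
    (Finset.card_pos.1 (by omega)) hRD (by omega)
  have h := card_add_card_class_le hS hD hm
  rw [hr, Finset.mem_singleton] at hm'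
  rw [Finset.filter_true_of_mem (fun a ha => (hmem a ha).trans hm'.symm)] at h
  omega

theorem card_filter_range_mul_mod_mem {K Q : ℕ} {T : Finset ℕ} (hT : T ⊆ Finset.range Q) :
    ({j ∈ Finset.range (K * Q) | j % Q ∈ T} : Finset ℕ).card = K * T.card := by
  have hQ : ({j ∈ Finset.range Q | j % Q ∈ T} : Finset ℕ) = T := by
    ext a
    rw [Finset.mem_filter, Finset.mem_range]
    constructor
    · rintro ⟨h1, h2⟩
      rwa [Nat.mod_eq_of_lt h1] at h2
    · intro h
      have h1 := Finset.mem_range.1 (hT h)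
      exact ⟨h1, by rwa [Nat.mod_eq_of_lt h1]⟩
  rw [← Nat.count_eq_card_filter_range]
  induction K with
  | zero => simp
  | succ K ih =>
    rw [Nat.succ_mul, Nat.count_add, ih, Nat.succ_mul]
    congr 1
    simp only [Nat.mul_add_mod_self_right]
    rw [Nat.count_eq_card_filter_range, hQ]

/-- The pair support of a `K`-fold repetition. -/
theorem card_pairSupport_of_periodic {K Q : ℕ} {S T : Finset ℕ}
    (hST : ∀ j, j ∈ S ↔ j < K * Q ∧ j % Q ∈ T) :
    (pairSupport (K * Q) S).card = K * (pairSupport Q T).card := by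
  rw [← card_filter_range_mul_mod_mem (T := pairSupport Q T) (Finset.filter_subset _ _)]
  congr 1
  ext j
  simp only [pairSupport, Finset.mem_filter, Finset.mem_range]
  refine and_congr_right fun hj => ?_
  have h0 : 0 < K * Q := by omega
  have hQ : 0 < Q := Nat.pos_of_mul_pos_left h0
  rw [hST, hST, Nat.mod_mod_of_dvd _ (Dvd.intro_left K rfl), Nat.mod_add_mod]
  simp [hj, Nat.mod_lt _ h0, Nat.mod_lt _ hQ]

end SymbolPair

/-! ### Residue parts, the Euler operator and Hamming weights. -/

namespace SymbolPair

section Residue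

variable {R : Type*} [Semiring R]

/-- The polynomial whose `m`-th coefficient is the coefficient of `P` at `D * m + r`. -/
noncomputable def residuePart (D r : ℕ) (P : R[X]) : R[X] :=
  ∑ m ∈ Finset.range (P.natDegree + 1), monomial m (P.coeff (D * m + r))

theorem coeff_residuePart {D r : ℕ} (hD : 0 < D) (P : R[X]) (m : ℕ) :
    (residuePart D r P).coeff m = P.coeff (D * m + r) := by
  simp only [residuePart, finsetSum_coeff, coeff_monomial, Finset.sum_ite_eq', Finset.mem_range]
  split_ifs with h
  · rfl
  · rw [coeff_eq_zero_of_natDegree_lt]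
    have := Nat.le_mul_of_pos_left m hD
    omega

theorem card_support_residuePart {D r : ℕ} (hr : r < D) (P : R[X]) :
    (residuePart D r P).support.card = ({j ∈ P.support | j % D = r} : Finset ℕ).card := by
  have hD : 0 < D := by omega
  refine Finset.card_bij (fun m _ => D * m + r) ?_ ?_ ?_
  · intro m hm
    rw [mem_support_iff, coeff_residuePart hD] at hm
    rw [Finset.mem_filter, mem_support_iff, Nat.mul_add_mod, Nat.mod_eq_of_lt hr]
    exact ⟨hm, rfl⟩
  · intro a _ b _ hab
    exact Nat.eq_of_mul_eq_mul_left hD (Nat.add_right_cancel hab)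
  · intro j hj
    obtain ⟨h1, h2⟩ := Finset.mem_filter.1 hj
    have h3 : D * (j / D) + r = j := by rw [← h2]; exact Nat.div_add_mod j D
    refine ⟨j / D, ?_, h3⟩
    rw [mem_support_iff, coeff_residuePart hD, h3]
    exact mem_support_iff.1 h1

theorem natDegree_residuePart_lt {D r M : ℕ} {P : R[X]} (hD : 0 < D) (hM : 0 < M)
    (hP : P.natDegree < D * M) : (residuePart D r P).natDegree < M := by
  refine lt_of_le_of_lt ((natDegree_le_iff_coeff_eq_zero (n := M - 1)).2 ?_)
    (Nat.sub_lt hM one_pos)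
  intro m hm
  rw [coeff_residuePart hD]
  apply coeff_eq_zero_of_natDegree_lt
  have : D * M ≤ D * m := Nat.mul_le_mul_left D (by omega)
  omega

theorem residuePart_ne_zero {D r : ℕ} {P : R[X]} (hD : 0 < D)
    (hr : r ∈ P.support.image (· % D)) : residuePart D r P ≠ 0 := by
  obtain ⟨j, hj, rfl⟩ := Finset.mem_image.1 hr
  intro h
  apply mem_support_iff.1 hj
  have := coeff_residuePart (r := j % D) hD P (j / D)
  rwa [Nat.div_add_mod, h, coeff_zero, eq_comm] at this

end Residue

section CommRing

variable {R : Type*} [CommRing R]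

/-- A polynomial in `X^D` shifts exponents by multiples of `D`, hence acts on each residue class
separately. -/
theorem residuePart_expand_mul {D r : ℕ} (hr : r < D) (A P : R[X]) :
    residuePart D r (expand R D A * P) = A * residuePart D r P := by
  have hD : 0 < D := by omega
  ext m
  rw [coeff_residuePart hD]
  induction A using Polynomial.induction_on' generalizing m with
  | add A B hA hB => rw [map_add, add_mul, add_mul, coeff_add, coeff_add, hA, hB]
  | monomial a c =>
    rw [expand_monomial, ← C_mul_X_pow_eq_monomial, ← C_mul_X_pow_eq_monomial, mul_assoc,
      mul_assoc, coeff_C_mul, coeff_C_mul, coeff_X_pow_mul', coeff_X_pow_mul',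
      coeff_residuePart hD]
    congr 1
    by_cases h : a ≤ m
    · have h1 : a * D ≤ m * D := Nat.mul_le_mul_right D h
      rw [if_pos h, if_pos (by rw [mul_comm D m]; omega)]
      congr 1
      obtain ⟨t, rfl⟩ := Nat.exists_eq_add_of_le h
      rw [Nat.add_sub_cancel_left, Nat.mul_add, mul_comm D a]
      omega
    · have h1 : (m + 1) * D ≤ a * D := Nat.mul_le_mul_right D (by omega)
      rw [if_neg h, if_neg]
      rw [Nat.succ_mul] at h1
      rw [mul_comm D m]
      omega

theorem dvd_residuePart {D r : ℕ} (hr : r < D) {A P : R[X]} (h : expand R D A ∣ P) :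
    A ∣ residuePart D r P := by
  obtain ⟨B, rfl⟩ := h
  exact ⟨_, residuePart_expand_mul hr A B⟩

theorem expand_X_sub_C_pow (D t : ℕ) (b : R) :
    expand R D ((X - C b) ^ t) = (X ^ D - C b) ^ t := by
  simp

/-- A polynomial supported in one residue class is recovered from its residue part. -/
theorem eq_X_pow_mul_expand_residuePart {D r : ℕ} {P : R[X]} (hr : r < D)
    (hP : ∀ j ∈ P.support, j % D = r) : P = X ^ r * expand R D (residuePart D r P) := by
  have hD : 0 < D := by omega
  ext j
  rw [coeff_X_pow_mul', coeff_expand hD]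
  by_cases hj : j % D = r
  · have h1 : D * (j / D) + r = j := by rw [← hj]; exact Nat.div_add_mod j D
    have h2 : j - r = D * (j / D) := by omega
    rw [if_pos (by omega), h2, if_pos (dvd_mul_right _ _), Nat.mul_div_cancel_left _ hD,
      coeff_residuePart hD, h1]
  · have h0 : P.coeff j = 0 := by
      by_contra h
      exact hj (hP j (mem_support_iff.2 h))
    rw [h0]
    split_ifs with h1 h2
    · exfalso
      obtain ⟨t, ht⟩ := h2
      apply hj
      rw [show j = D * t + r by omega, Nat.mul_add_mod, Nat.mod_eq_of_lt hr]
    · rfl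
    · rfl

/-- The operator `X d/dX - r`, which multiplies the `j`-th coefficient by `j - r`. -/
noncomputable def eulerSub (r : ℕ) (P : R[X]) : R[X] :=
  X * derivative P - C (r : R) * P

theorem coeff_eulerSub (r : ℕ) (P : R[X]) (j : ℕ) :
    (eulerSub r P).coeff j = ((j : R) - r) * P.coeff j := by
  rw [eulerSub, coeff_sub, coeff_C_mul, sub_mul]
  congr 1
  cases j with
  | zero => simp
  | succ j =>
    rw [coeff_X_mul, coeff_derivative, mul_comm]
    push_cast
    rfl

theorem dvd_eulerSub {A P : R[X]} {t : ℕ} (r : ℕ) (h : A ^ (t + 1) ∣ P) :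
    A ^ t ∣ eulerSub r P := by
  apply dvd_sub
  · exact Dvd.dvd.mul_left (pow_sub_one_dvd_derivative_of_pow_dvd h) X
  · exact Dvd.dvd.mul_left ((pow_dvd_pow A (Nat.le_succ t)).trans h) _

end CommRing

variable {F : Type*} [Field F]

theorem support_eulerSub (p : ℕ) [CharP F p] (r : ℕ) (P : F[X]) :
    (eulerSub r P).support = {j ∈ P.support | j % p ≠ r % p} := by
  ext j
  rw [mem_support_iff, coeff_eulerSub, Finset.mem_filter, mem_support_iff, mul_ne_zero_iff,
    sub_ne_zero, Ne, CharP.natCast_eq_natCast F p, and_comm]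
  rfl

theorem one_lt_card_support {a : F} (ha : a ≠ 0) {P : F[X]} (hP : P ≠ 0) (h : X - C a ∣ P) :
    2 ≤ P.support.card := by
  by_contra hcon
  have hpos : 0 < P.support.card := Finset.card_pos.2 (nonempty_support_iff.2 hP)
  obtain ⟨k, x, hx, rfl⟩ := card_support_eq_one.1 (show P.support.card = 1 by omega)
  have := dvd_iff_isRoot.1 h
  simp [hx, ha] at this

/-- A polynomial of degree less than the characteristic with a nonzero root of multiplicity `t`
has at least `t + 1` terms. -/
theorem lt_card_support_of_natDegree_lt (p : ℕ) [CharP F p] {a : F} (ha : a ≠ 0) {t : ℕ}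
    {P : F[X]} (hP : P ≠ 0) (hdeg : P.natDegree < p) (h : (X - C a) ^ t ∣ P) :
    t + 1 ≤ P.support.card := by
  induction t generalizing P with
  | zero => exact Finset.card_pos.2 (nonempty_support_iff.2 hP)
  | succ t ih =>
    have h2 := one_lt_card_support ha hP ((dvd_pow_self _ (Nat.succ_ne_zero t)).trans h)
    obtain ⟨r, hr⟩ := nonempty_support_iff.2 hP
    have hlt : ∀ j ∈ P.support, j < p := fun j hj => (le_natDegree_of_mem_supp j hj).trans_lt hdeg
    -- All exponents are below `p`, so only `r` itself is congruent to `r` and exactly one term is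
    -- lost.
    have hsupp : (eulerSub r P).support = P.support.erase r := by
      rw [support_eulerSub p]
      ext j
      rw [Finset.mem_filter, Finset.mem_erase, and_comm]
      refine and_congr_left fun hj => ?_
      rw [Nat.mod_eq_of_lt (hlt j hj), Nat.mod_eq_of_lt (hlt r hr)]
    have hcard := Finset.card_erase_of_mem hr
    have hne : eulerSub r P ≠ 0 := by
      rw [← nonempty_support_iff, ← Finset.card_pos, hsupp]
      omega
    have hdeg' : (eulerSub r P).natDegree < p := by
      apply hlt
      have := natDegree_mem_support_of_nonzero hne
      rw [hsupp] at this
      exact Finset.mem_of_mem_erase this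
    have := ih hne hdeg' (dvd_eulerSub r h)
    rw [hsupp] at this
    omega

/-- `eulerSub r` kills the class of `r`; a second class keeps the result nonzero and divisible by `X
- a`, so two terms remain besides `r`. -/
theorem three_le_card_support_of_sq_dvd (p : ℕ) [CharP F p] {a : F} (ha : a ≠ 0)
    {P : F[X]} (h : (X - C a) ^ 2 ∣ P) (hcl : 2 ≤ (P.support.image (· % p)).card) :
    3 ≤ P.support.card := by
  obtain ⟨x, hx, y, hy, hxy⟩ := Finset.one_lt_card.1 hcl
  obtain ⟨r, hr, rfl⟩ := Finset.mem_image.1 hx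
  obtain ⟨j, hj, rfl⟩ := Finset.mem_image.1 hy
  have hj' : j ∈ (eulerSub r P).support := by
    rw [support_eulerSub p, Finset.mem_filter]
    exact ⟨hj, fun e => hxy e.symm⟩
  have h1 := one_lt_card_support ha (nonempty_support_iff.1 ⟨j, hj'⟩)
    (by simpa using dvd_eulerSub (t := 1) r h)
  have h2 : (eulerSub r P).support ⊆ P.support.erase r := by
    intro b hb
    rw [support_eulerSub p, Finset.mem_filter] at hb
    exact Finset.mem_erase.2 ⟨fun e => hb.2 (by rw [e]), hb.1⟩
  have h3 := Finset.card_le_card h2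
  rw [Finset.card_erase_of_mem hr] at h3
  omega

theorem lt_card_residueClass (p : ℕ) [CharP F p] {b : F} (hb : b ≠ 0) {D t r : ℕ}
    (hp : 0 < p) (hD : 0 < D) {P : F[X]} (hdeg : P.natDegree < D * p)
    (h : (X ^ D - C b) ^ t ∣ P) (hr : r ∈ P.support.image (· % D)) :
    t + 1 ≤ ({j ∈ P.support | j % D = r} : Finset ℕ).card := by
  have hrD : r < D := by
    obtain ⟨j, _, rfl⟩ := Finset.mem_image.1 hr
    exact Nat.mod_lt _ hD
  rw [← expand_X_sub_C_pow] at h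
  rw [← card_support_residuePart hrD]
  exact lt_card_support_of_natDegree_lt p hb (residuePart_ne_zero hD hr)
    (natDegree_residuePart_lt hD hp hdeg) (dvd_residuePart hrD h)

theorem image_mod_card_pos {P : F[X]} (hP : P ≠ 0) (D : ℕ) :
    0 < (P.support.image (· % D)).card :=
  Finset.card_pos.2 ((nonempty_support_iff.2 hP).image _)

theorem X_sub_C_pow_pow_mul (p : ℕ) [Fact p.Prime] [CharP F p] (A : F[X]) (a : F)
    (u t : ℕ) : (A - C a) ^ (t * p ^ u) = (A ^ p ^ u - C (a ^ p ^ u)) ^ t := by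
  rw [mul_comm, pow_mul, sub_pow_char_pow, C_pow]

/-- Hamming weights of multiples of `(X - a) ^ (θ q + 1)`, where `q = p ^ u`, of degree
less than `p q`. -/
theorem add_two_le_card_support (p : ℕ) [hp : Fact p.Prime] [CharP F p] {a : F} (ha : a ≠ 0)
    {u θ : ℕ} {P : F[X]} (hP : P ≠ 0) (hdeg : P.natDegree < p ^ u * p)
    (h : (X - C a) ^ (θ * p ^ u + 1) ∣ P) : θ + 2 ≤ P.support.card := by
  have hp0 := hp.out.pos
  have hq : 0 < p ^ u := pow_pos hp0 u
  have hb : a ^ p ^ u ≠ 0 := pow_ne_zero _ ha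
  have h' : (X ^ p ^ u - C (a ^ p ^ u)) ^ θ ∣ P := by
    rw [← X_sub_C_pow_pow_mul]
    exact (pow_dvd_pow _ (Nat.le_succ _)).trans h
  have hm := image_mod_card_pos hP (p ^ u)
  rcases Nat.lt_or_ge 1 (P.support.image (· % p ^ u)).card with hm2 | hm1
  · have := Finset.mul_card_image_le_card (f := (· % p ^ u)) P.support (θ + 1) (fun r hr =>
      lt_card_residueClass p hb hp0 hq hdeg h' hr)
    have := (Nat.mul_le_mul_left (θ + 1) hm2).trans this
    omega
  -- With one class, `P` is `X^r` times a polynomial in `X^(p^u)`. The one surplus factor `X - a`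
  -- then forces a further root at `a^(p^u)`, raising the multiplicity from `θ` to `θ + 1`.
  · obtain ⟨r, hr⟩ := Finset.card_eq_one.1
      (show (P.support.image (· % p ^ u)).card = 1 by omega)
    have hrmem : r ∈ P.support.image (· % p ^ u) := by rw [hr]; exact Finset.mem_singleton_self r
    have hall : ∀ j ∈ P.support, j % p ^ u = r := fun j hj => by
      simpa [hr] using Finset.mem_image_of_mem (· % p ^ u) hj
    have hrD : r < p ^ u := by
      obtain ⟨j, _, hj⟩ := Finset.mem_image.1 hrmem
      rw [← hj]
      exact Nat.mod_lt _ hq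
    have hPeq := eq_X_pow_mul_expand_residuePart hrD hall
    have hT := dvd_residuePart (A := (X - C (a ^ p ^ u)) ^ θ) (P := P) hrD
      (by rw [expand_X_sub_C_pow]; exact h')
    obtain ⟨B, hB⟩ := hT
    have hroot : B.IsRoot (a ^ p ^ u) := by
      rw [hPeq, hB, map_mul, expand_X_sub_C_pow, ← X_sub_C_pow_pow_mul, mul_left_comm,
        pow_succ] at h
      have h1 := dvd_iff_isRoot.1
        ((mul_dvd_mul_iff_left (pow_ne_zero _ (X_sub_C_ne_zero a))).1 h)
      simpa [ha, expand_eval] using h1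
    have hfin : (X - C (a ^ p ^ u)) ^ (θ + 1) ∣ residuePart (p ^ u) r P := by
      rw [hB, pow_succ]
      exact mul_dvd_mul_left _ (dvd_iff_isRoot.2 hroot)
    have := lt_card_support_of_natDegree_lt p hb (residuePart_ne_zero hq hrmem)
      (natDegree_residuePart_lt hq hp0 hdeg) hfin
    rw [card_support_residuePart hrD] at this
    exact this.trans (Finset.card_le_card (Finset.filter_subset _ _))

/-! ### Lower bounds for pair weights in the reduced length. -/

theorem support_subset_range {P : F[X]} {N : ℕ} (h : P.natDegree < N) :
    P.support ⊆ Finset.range N := fun j hj =>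
  Finset.mem_range.2 ((le_natDegree_of_mem_supp j hj).trans_lt h)

/-- Pair weights for `n ≥ 2`. -/
theorem two_mul_le_card_pairSupport_of_two_le (p : ℕ) [hp : Fact p.Prime] [CharP F p] {a : F}
    (ha : a ≠ 0) {n u θ : ℕ} (hn : 2 ≤ n) {P : F[X]} (hP : P ≠ 0)
    (hdeg : P.natDegree < n * p ^ (u + 1)) (h : (X ^ n - C a) ^ (θ * p ^ u + 1) ∣ P) :
    2 * (θ + 2) ≤ (pairSupport (n * p ^ (u + 1)) P.support).card := by
  have hp0 := hp.out.pos
  have hn0 : 0 < n := by omega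
  have hS := support_subset_range hdeg
  have hcl : ∀ r ∈ P.support.image (· % n),
      θ + 2 ≤ ({j ∈ P.support | j % n = r} : Finset ℕ).card := by
    intro r hr
    have hrn : r < n := by
      obtain ⟨j, _, rfl⟩ := Finset.mem_image.1 hr
      exact Nat.mod_lt _ hn0
    rw [← card_support_residuePart hrn]
    refine add_two_le_card_support p ha (u := u) (residuePart_ne_zero hn0 hr) ?_
      (dvd_residuePart hrn (by rwa [expand_X_sub_C_pow]))
    rw [← pow_succ]
    exact natDegree_residuePart_lt hn0 (pow_pos hp0 _) hdeg
  have hw := Finset.mul_card_image_le_card (f := (· % n)) P.support (θ + 2) hcl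
  have hm := image_mod_card_pos hP n
  rcases Nat.lt_or_ge 1 (P.support.image (· % n)).card with hm2 | hm1
  · have h1 := (Nat.mul_le_mul_left (θ + 2) hm2).trans hw
    have h2 := card_le_card_pairSupport hS
    omega
  · have h1 := two_mul_card_le_card_pairSupport hS (dvd_mul_right n _) hn (by omega)
    have h2 := (Nat.mul_le_mul_left (θ + 2) hm).trans hw
    omega

/-- Pair weights for `n = 1` and `θ ≥ 1`. -/
theorem two_mul_le_card_pairSupport_of_one_le (p : ℕ) [hp : Fact p.Prime] [CharP F p] {a : F}
    (ha : a ≠ 0) {u θ : ℕ} (hu : 1 ≤ u) (hθ : 1 ≤ θ) (hθp : θ + 2 ≤ p) {P : F[X]} (hP : P ≠ 0)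
    (hdeg : P.natDegree < p ^ (u + 1)) (h : (X - C a) ^ (θ * p ^ u + 1) ∣ P) :
    2 * (θ + 2) ≤ (pairSupport (p ^ (u + 1)) P.support).card := by
  have hp0 := hp.out.pos
  have hpq : p ≤ p ^ u := by simpa using Nat.pow_le_pow_right hp0 hu
  have hq : 0 < p ^ u := by omega
  have hb : a ^ p ^ u ≠ 0 := pow_ne_zero _ ha
  have h' : (X ^ p ^ u - C (a ^ p ^ u)) ^ θ ∣ P := by
    rw [← X_sub_C_pow_pow_mul]
    exact (pow_dvd_pow _ (Nat.le_succ _)).trans h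
  have hS := support_subset_range hdeg
  have hdvd : p ^ u ∣ p ^ (u + 1) := pow_dvd_pow p (Nat.le_succ u)
  rw [pow_succ] at hdeg
  have hcl : ∀ r ∈ P.support.image (· % p ^ u),
      θ + 1 ≤ ({j ∈ P.support | j % p ^ u = r} : Finset ℕ).card := fun r hr =>
    lt_card_residueClass p hb hp0 hq hdeg h' hr
  have hw := Finset.mul_card_image_le_card (f := (· % p ^ u)) P.support (θ + 1) hcl
  have hm := image_mod_card_pos hP (p ^ u)
  rcases Nat.lt_or_ge 2 (P.support.image (· % p ^ u)).card with hm3 | hm2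
  -- Three classes: weight at least `3(θ+1) ≥ 2θ + 3`, and one further position.
  · have h1 := (Nat.mul_le_mul_left (θ + 1) hm3).trans hw
    apply min_le_card_pairSupport (v := 2 * θ + 3) hS (nonempty_support_iff.2 hP)
    · have h2 : p * p ≤ p ^ u * p := Nat.mul_le_mul_right p hpq
      have h3 : 2 * p ≤ p * p := Nat.mul_le_mul_right p (by omega)
      rw [pow_succ]
      omega
    · omega
  · rcases Nat.lt_or_ge 1 (P.support.image (· % p ^ u)).card with hm2' | hm1
    · have hRD : P.support.image (· % p ^ u) ⊆ Finset.range (p ^ u) := by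
        intro r hr
        obtain ⟨j, _, rfl⟩ := Finset.mem_image.1 hr
        exact Finset.mem_range.2 (Nat.mod_lt _ hq)
      -- Two classes out of `p^u ≥ 3`: one follows an empty class and counts twice, giving `3(θ+1) ≥
      -- 2θ + 4` since `θ ≥ 1`.
      obtain ⟨m, hm, hm'⟩ := exists_mod_notMem_succ_mod_mem (Finset.card_pos.1 hm) hRD
        (by omega)
      have h1 := card_add_card_class_le hS hdvd hm
      have h2 := hcl _ hm'
      have h3 := (Nat.mul_le_mul_left (θ + 1) hm2').trans hw
      omega
    · have h1 := two_mul_card_le_card_pairSupport hS hdvd (by omega) (by omega)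
      have h2 := add_two_le_card_support p ha hP hdeg h
      omega

theorem four_le_card_pairSupport (p : ℕ) [hp : Fact p.Prime] [CharP F p] {a : F}
    (ha : a ≠ 0) {u : ℕ} (hu : 1 ≤ u) {P : F[X]} (hP : P ≠ 0)
    (hdeg : P.natDegree < p ^ (u + 1)) (h : (X - C a) ^ 2 ∣ P) :
    4 ≤ (pairSupport (p ^ (u + 1)) P.support).card := by
  have hS := support_subset_range hdeg
  have hm := image_mod_card_pos hP p
  rcases Nat.lt_or_ge 1 (P.support.image (· % p)).card with hm2 | hm1
  · refine min_le_card_pairSupport hS (nonempty_support_iff.2 hP) ?_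
      (three_le_card_support_of_sq_dvd p ha h hm2)
    calc 4 = 2 ^ 2 := rfl
      _ ≤ p ^ 2 := Nat.pow_le_pow_left hp.out.two_le 2
      _ ≤ p ^ (u + 1) := Nat.pow_le_pow_right hp.out.pos (by omega)
  · have h1 := two_mul_card_le_card_pairSupport hS (dvd_pow_self p (Nat.succ_ne_zero u))
      hp.out.two_le (by omega)
    have h2 := one_lt_card_support ha hP ((dvd_pow_self _ two_ne_zero).trans h)
    omega

end SymbolPair

/-! ### Repetition, and the passage from codes to polynomials. -/

namespace SymbolPair

variable {F : Type*} [Field F]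

/-- The shifts of `G` by multiples of `Q` do not overlap. -/
theorem coeff_geomSum_mul {K Q : ℕ} (b : F) {G : F[X]} (hG : G.natDegree < Q) (j : ℕ) :
    ((∑ i ∈ Finset.range K, (X ^ Q) ^ i * C b ^ (K - 1 - i)) * G).coeff j =
      if j < K * Q then b ^ (K - 1 - j / Q) * G.coeff (j % Q) else 0 := by
  have hQ : 0 < Q := by omega
  have hterm : ∀ i, ((X ^ Q) ^ i * C b ^ (K - 1 - i) * G).coeff j =
      if i = j / Q then b ^ (K - 1 - j / Q) * G.coeff (j % Q) else 0 := by
    intro i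
    rw [← C_pow, ← pow_mul, mul_assoc, mul_left_comm, coeff_C_mul, coeff_X_pow_mul']
    have hj := Nat.div_add_mod j Q
    have hlt := Nat.mod_lt j hQ
    split_ifs with h1 h2 h2
    · subst h2
      congr 2
      omega
    · rw [coeff_eq_zero_of_natDegree_lt, mul_zero]
      have h3 : i ≤ j / Q := (Nat.le_div_iff_mul_le hQ).2 (by rwa [mul_comm])
      have h4 : Q * (i + 1) ≤ Q * (j / Q) := Nat.mul_le_mul_left Q (by omega)
      rw [Nat.mul_succ] at h4
      omega
    · exfalso
      subst h2
      omega
    · rw [mul_zero]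
  rw [Finset.sum_mul, finsetSum_coeff]
  simp only [hterm, Finset.sum_ite_eq', Finset.mem_range, Nat.div_lt_iff_lt_mul hQ]

theorem pow_sub_eq_geomSum (p : ℕ) [hp : Fact p.Prime] [CharP F p] {n : ℕ} (hn : 0 < n) (a : F)
    (k w : ℕ) : (X ^ n - C a) ^ (p ^ (k + w) - p ^ w) =
      ∑ i ∈ Finset.range (p ^ k), (X ^ (n * p ^ w)) ^ i * C (a ^ p ^ w) ^ (p ^ k - 1 - i) := by
  have hne : (X ^ (n * p ^ w) - C (a ^ p ^ w) : F[X]) ≠ 0 :=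
    X_pow_sub_C_ne_zero (Nat.mul_pos hn (pow_pos hp.out.pos w)) _
  -- Multiplied by `X^(n p^w) - a^(p^w)`, both sides become `X^(n p^(k+w)) - a^(p^(k+w))`.
  apply mul_right_cancel₀ hne
  rw [(Commute.all _ _).geom_sum₂_mul, pow_add, ← Nat.sub_one_mul, X_sub_C_pow_pow_mul, ← pow_mul,
    pow_sub_one_mul (pow_pos hp.out.pos k).ne', sub_pow_char_pow]

/-- Multiplying by `(X ^ n - a) ^ (p ^ (k + w) - p ^ w)` repeats a polynomial of small degree
`p ^ k` times, up to nonzero factors. -/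
theorem card_pairSupport_pow_mul (p : ℕ) [hp : Fact p.Prime] [CharP F p] {n : ℕ} {a : F}
    (ha : a ≠ 0) (k w : ℕ) {G : F[X]} (hG : G.natDegree < n * p ^ w) :
    (pairSupport (n * p ^ (k + w)) ((X ^ n - C a) ^ (p ^ (k + w) - p ^ w) * G).support).card =
      p ^ k * (pairSupport (n * p ^ w) G.support).card := by
  have hn : 0 < n := Nat.pos_of_mul_pos_right (by omega : 0 < n * p ^ w)
  rw [pow_sub_eq_geomSum p hn, pow_add, mul_left_comm]
  refine card_pairSupport_of_periodic fun j => ?_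
  rw [mem_support_iff, coeff_geomSum_mul _ hG, mem_support_iff]
  split_ifs with h
  · simp [h, ha]
  · simp [h]

theorem binomial_pow_dvd (p : ℕ) [Fact p.Prime] [CharP F p] (n s i : ℕ) (a : F)
    (hi : i ≤ p ^ s) : (X ^ n - C a) ^ i ∣ (X ^ (n * p ^ s) - C (a ^ p ^ s) : F[X]) := by
  rw [pow_mul, C_pow, ← sub_pow_char_pow]
  exact pow_dvd_pow _ hi

section Bridge

variable [DecidableEq F]

theorem mk_ofFn (N : ℕ) (α : F) (c : Fin N → F) :
    AdjoinRoot.mk (X ^ N - C α : F[X]) (ofFn N c) = polyRep N α c := by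
  rw [ofFn_eq_sum_monomial, map_sum, polyRep, Fintype.linearCombination_apply]
  refine Finset.sum_congr rfl fun j _ => ?_
  rw [← C_mul_X_pow_eq_monomial, map_mul, map_pow, AdjoinRoot.mk_X, AdjoinRoot.mk_C,
    Algebra.smul_def]
  rfl

theorem mem_binomialCode {N n i : ℕ} {α α₀ : F} (h : (X ^ n - C α₀) ^ i ∣ (X ^ N - C α : F[X]))
    (c : Fin N → F) : c ∈ binomialCode N α n α₀ i ↔ (X ^ n - C α₀) ^ i ∣ ofFn N c := by
  rw [binomialCode, codeOfIdeal, Submodule.mem_comap, Submodule.restrictScalars_mem,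
    Ideal.mem_span_singleton, ← mk_ofFn]
  constructor
  · rintro ⟨b, hb⟩
    obtain ⟨B, rfl⟩ := AdjoinRoot.mk_surjective b
    rw [← map_mul, AdjoinRoot.mk_eq_mk] at hb
    exact (dvd_sub_left (dvd_mul_right _ _)).1 (h.trans hb)
  · exact map_dvd _

theorem finRotate_val {N : ℕ} (j : Fin N) : (finRotate N j : ℕ) = (j + 1) % N := by
  cases N with
  | zero => exact j.elim0
  | succ N => rw [finRotate_apply, Fin.val_add, Fin.val_one', Nat.add_mod_mod]

theorem pairDist_eq_card_pairSupport {N : ℕ} (x y : Fin N → F) :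
    pairDist x y = (pairSupport N (ofFn N (x - y)).support).card := by
  rw [pairDist, hammingDist]
  refine Finset.card_bij (fun j _ => (j : ℕ)) ?_ (fun a _ b _ h => Fin.ext h) ?_
  · intro j hj
    rw [pairSupport, Finset.mem_filter, Finset.mem_range, ← finRotate_val, mem_support_iff,
      mem_support_iff, ofFn_coeff_eq_val_of_lt _ j.2, ofFn_coeff_eq_val_of_lt _ (Fin.is_lt _)]
    refine ⟨j.2, ?_⟩
    simpa [pairVector, sub_eq_zero, imp_iff_not_or] using hj
  · intro j hj
    obtain ⟨h1, h2⟩ := Finset.mem_filter.1 hj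
    rw [Finset.mem_range] at h1
    refine ⟨⟨j, h1⟩, ?_, rfl⟩
    have h3 : (j + 1) % N = (finRotate N ⟨j, h1⟩ : ℕ) := (finRotate_val ⟨j, h1⟩).symm
    rw [h3, mem_support_iff, mem_support_iff, ofFn_coeff_eq_val_of_lt _ h1,
      ofFn_coeff_eq_val_of_lt _ (Fin.is_lt _)] at h2
    simpa [pairVector, sub_eq_zero, imp_iff_not_or] using h2

theorem minPairDist_eq {N v : ℕ} {𝒞 : Submodule F (Fin N → F)}
    (hlow : ∀ c ∈ 𝒞, c ≠ 0 → v ≤ (pairSupport N (ofFn N c).support).card)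
    (hup : ∃ c ∈ 𝒞, c ≠ 0 ∧ (pairSupport N (ofFn N c).support).card ≤ v) :
    minPairDist (𝒞 : Set (Fin N → F)) = v := by
  obtain ⟨c, hc, hc0, hcv⟩ := hup
  apply le_antisymm
  · refine le_trans (Nat.sInf_le ⟨c, hc, 0, 𝒞.zero_mem, hc0, rfl⟩) ?_
    rwa [pairDist_eq_card_pairSupport, sub_zero]
  · refine le_csInf ⟨_, c, hc, 0, 𝒞.zero_mem, hc0, rfl⟩ ?_
    rintro d ⟨x, hx, y, hy, hxy, rfl⟩
    rw [pairDist_eq_card_pairSupport]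
    exact hlow _ (𝒞.sub_mem hx hy) (sub_ne_zero.2 hxy)

/-- The symbol-pair distance of `⟨(x ^ n - α₀) ^ i⟩` is `p ^ k` times the least pair weight
among the multiples of a smaller power of `x ^ n - α₀` in length `n * p ^ w`. -/
theorem minPairDist_binomialCode (p : ℕ) [hp : Fact p.Prime] [CharP F p] {n : ℕ} (hn : 0 < n)
    {a : F} (ha : a ≠ 0) (k w i v : ℕ) (hi : i ≤ p ^ w)
    (hlow : ∀ G : F[X], G ≠ 0 → G.natDegree < n * p ^ w → (X ^ n - C a) ^ i ∣ G →
      v ≤ (pairSupport (n * p ^ w) G.support).card)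
    (hup : ∃ G : F[X], G ≠ 0 ∧ G.natDegree < n * p ^ w ∧ (X ^ n - C a) ^ i ∣ G ∧
      (pairSupport (n * p ^ w) G.support).card ≤ v) :
    minPairDist (binomialCode (n * p ^ (k + w)) (a ^ p ^ (k + w)) n a
      (p ^ (k + w) - p ^ w + i) : Set (Fin (n * p ^ (k + w)) → F)) = p ^ k * v := by
  have hN : 1 ≤ n * p ^ (k + w) := Nat.mul_pos hn (pow_pos hp.out.pos _)
  have hle : p ^ w ≤ p ^ (k + w) := Nat.pow_le_pow_right hp.out.pos (by omega)
  have hmem := mem_binomialCode (binomial_pow_dvd p n (k + w) (p ^ (k + w) - p ^ w + i) a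
    (by omega))
  have hE : (X ^ n - C a : F[X]) ^ (p ^ (k + w) - p ^ w) ≠ 0 :=
    pow_ne_zero _ (X_pow_sub_C_ne_zero hn a)
  have hdE : ((X ^ n - C a : F[X]) ^ (p ^ (k + w) - p ^ w)).natDegree + n * p ^ w =
      n * p ^ (k + w) := by
    rw [natDegree_pow, natDegree_X_pow_sub_C, mul_comm _ n, ← Nat.mul_add,
      Nat.sub_add_cancel hle]
  apply minPairDist_eq
  · intro c hc hc0
    obtain ⟨B, hB⟩ := (hmem c).1 hc
    replace hB := hB.trans (congrArg (· * B) (pow_add _ _ _))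
    rw [mul_assoc] at hB
    have hP0 : ofFn _ c ≠ 0 := fun h => hc0 (injective_ofFn _ (by rw [h, map_zero]))
    have hG0 : (X ^ n - C a) ^ i * B ≠ 0 := fun h => hP0 (by rw [hB, h, mul_zero])
    have hdeg := ofFn_natDegree_lt hN c
    rw [hB, natDegree_mul hE hG0] at hdeg
    have hGd : ((X ^ n - C a) ^ i * B).natDegree < n * p ^ w := by omega
    rw [hB, card_pairSupport_pow_mul p ha k w hGd]
    exact Nat.mul_le_mul_left _ (hlow _ hG0 hGd (dvd_mul_right _ _))
  · obtain ⟨G, hG0, hGd, hdvd, hGv⟩ := hup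
    have hP : ((X ^ n - C a) ^ (p ^ (k + w) - p ^ w) * G).natDegree < n * p ^ (k + w) := by
      rw [natDegree_mul hE hG0]
      omega
    have hof := ofFn_comp_toFn_eq_id_of_natDegree_lt hP
    refine ⟨toFn _ ((X ^ n - C a) ^ (p ^ (k + w) - p ^ w) * G), (hmem _).2 ?_, ?_, ?_⟩
    · rw [hof, pow_add _ (p ^ (k + w) - p ^ w) i]
      exact mul_dvd_mul_left _ hdvd
    · intro h
      rw [h, map_zero] at hof
      exact mul_ne_zero hE hG0 hof.symm
    · rw [hof, card_pairSupport_pow_mul p ha k w hGd]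
      exact Nat.mul_le_mul_left _ hGv

/-- The generator already has degree `N`, so zero is the only codeword and the value is `sInf ∅`. -/
theorem minPairDist_binomialCode_top (p : ℕ) [hp : Fact p.Prime] [CharP F p] {n : ℕ}
    (hn : 0 < n) (s : ℕ) (a : F) :
    minPairDist (binomialCode (n * p ^ s) (a ^ p ^ s) n a (p ^ s) :
      Set (Fin (n * p ^ s) → F)) = 0 := by
  have hN : 1 ≤ n * p ^ s := Nat.mul_pos hn (pow_pos hp.out.pos _)
  have hzero : ∀ c ∈ binomialCode (n * p ^ s) (a ^ p ^ s) n a (p ^ s), c = 0 := by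
    intro c hc
    have h := (mem_binomialCode (binomial_pow_dvd p n s (p ^ s) a le_rfl) c).1 hc
    apply injective_ofFn
    rw [map_zero]
    apply eq_zero_of_dvd_of_natDegree_lt h
    rw [natDegree_pow, natDegree_X_pow_sub_C]
    exact (ofFn_natDegree_lt hN c).trans_eq (mul_comm _ _)
  rw [minPairDist, Nat.sInf_eq_zero]
  right
  rw [Set.eq_empty_iff_forall_notMem]
  rintro d ⟨x, hx, y, hy, hxy, -⟩
  exact hxy ((hzero x hx).trans (hzero y hy).symm)

end Bridge

end SymbolPair

/-! ### Minimum-weight words and the resulting distances. -/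

namespace SymbolPair

variable {F : Type*} [Field F]

theorem card_support_expand_le {D : ℕ} (hD : 0 < D) (A : F[X]) :
    (expand F D A).support.card ≤ A.support.card := by
  have h : (expand F D A).support ⊆ A.support.image (D * ·) := by
    intro j hj
    rw [mem_support_iff, coeff_expand hD] at hj
    split_ifs at hj with hdvd
    · exact Finset.mem_image.2 ⟨j / D, mem_support_iff.2 hj, Nat.mul_div_cancel' hdvd⟩
    · exact absurd rfl hj
  exact (Finset.card_le_card h).trans Finset.card_image_le

theorem card_support_binomial_pow_le (p : ℕ) [hp : Fact p.Prime] [CharP F p] {n : ℕ}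
    (hn : 0 < n) (a : F) (u t : ℕ) :
    ((X ^ n - C a : F[X]) ^ (t * p ^ u)).support.card ≤ t + 1 := by
  have hD : 0 < n * p ^ u := Nat.mul_pos hn (pow_pos hp.out.pos u)
  rw [X_sub_C_pow_pow_mul, ← pow_mul, ← expand_X_sub_C_pow]
  refine (card_support_expand_le hD _).trans ((card_supp_le_succ_natDegree _).trans ?_)
  rw [natDegree_pow, natDegree_X_sub_C, mul_one]

variable [DecidableEq F]

theorem minPairDist_binomialCode_two_mul (p : ℕ) [hp : Fact p.Prime] [CharP F p] {n : ℕ}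
    (hn : 0 < n) {a : F} (ha : a ≠ 0) (k u θ i : ℕ) (hθ : θ + 2 ≤ p)
    (hi : i ≤ (θ + 1) * p ^ u)
    (hlow : ∀ G : F[X], G ≠ 0 → G.natDegree < n * p ^ (u + 1) → (X ^ n - C a) ^ i ∣ G →
      2 * (θ + 2) ≤ (pairSupport (n * p ^ (u + 1)) G.support).card) :
    minPairDist (binomialCode (n * p ^ (k + (u + 1))) (a ^ p ^ (k + (u + 1))) n a
      (p ^ (k + (u + 1)) - p ^ (u + 1) + i) : Set (Fin (n * p ^ (k + (u + 1))) → F)) =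
      2 * (θ + 2) * p ^ k := by
  have hlt : (θ + 1) * p ^ u < p ^ (u + 1) := by
    rw [pow_succ, mul_comm (p ^ u)]
    exact Nat.mul_lt_mul_of_pos_right (by omega) (pow_pos hp.out.pos u)
  rw [mul_comm _ (p ^ k)]
  refine minPairDist_binomialCode p hn ha k (u + 1) i _ (by omega) hlow
    ⟨(X ^ n - C a) ^ ((θ + 1) * p ^ u), pow_ne_zero _ (X_pow_sub_C_ne_zero hn a), ?_,
      pow_dvd_pow _ hi, ?_⟩
  · rw [natDegree_pow, natDegree_X_pow_sub_C, mul_comm]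
    exact Nat.mul_lt_mul_of_pos_left hlt hn
  · exact (card_pairSupport_le_two_mul _ _).trans
      (Nat.mul_le_mul_left 2 (card_support_binomial_pow_le p hn a u (θ + 1)))

theorem minPairDist_binomialCode_zero (p : ℕ) [hp : Fact p.Prime] [CharP F p] {n s : ℕ}
    (hN : 2 ≤ n * p ^ s) {a : F} (ha : a ≠ 0) :
    minPairDist (binomialCode (n * p ^ s) (a ^ p ^ s) n a 0 : Set (Fin (n * p ^ s) → F)) = 2 := by
  have hn : 0 < n := Nat.pos_of_mul_pos_right (by omega : 0 < n * p ^ s)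
  have := minPairDist_binomialCode p hn ha 0 s 0 2 (Nat.zero_le _)
    (fun G hG hdeg _ => min_le_card_pairSupport (support_subset_range hdeg)
      (nonempty_support_iff.2 hG) hN (Finset.card_pos.2 (nonempty_support_iff.2 hG)))
    ⟨1, one_ne_zero, by rw [natDegree_one]; omega, by simp,
      (card_pairSupport_le_two_mul _ _).trans
        (Nat.mul_le_mul_left 2 (card_support_le_one_iff_monomial.2 ⟨0, 1, by simp⟩))⟩
  rw [pow_zero, one_mul, Nat.zero_add] at this
  simpa using this

theorem minPairDist_binomialCode_of_two_le (p : ℕ) [hp : Fact p.Prime] [CharP F p] {n : ℕ}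
    (hn : 2 ≤ n) {a : F} (ha : a ≠ 0) (k u θ i : ℕ) (hθ : θ + 2 ≤ p)
    (hi : θ * p ^ u + 1 ≤ i) (hi' : i ≤ (θ + 1) * p ^ u) :
    minPairDist (binomialCode (n * p ^ (k + (u + 1))) (a ^ p ^ (k + (u + 1))) n a
      (p ^ (k + (u + 1)) - p ^ (u + 1) + i) : Set (Fin (n * p ^ (k + (u + 1))) → F)) =
      2 * (θ + 2) * p ^ k :=
  minPairDist_binomialCode_two_mul p (by omega) ha k u θ i hθ hi' fun _ hG hdeg hdvd =>
    two_mul_le_card_pairSupport_of_two_le p ha hn hG hdeg ((pow_dvd_pow _ hi).trans hdvd)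

theorem minPairDist_binomialCode_one (p : ℕ) [hp : Fact p.Prime] [CharP F p]
    {a : F} (ha : a ≠ 0) (k u θ i : ℕ) (hu : 1 ≤ u) (hθ : 1 ≤ θ) (hθp : θ + 2 ≤ p)
    (hi : θ * p ^ u + 1 ≤ i) (hi' : i ≤ (θ + 1) * p ^ u) :
    minPairDist (binomialCode (1 * p ^ (k + (u + 1))) (a ^ p ^ (k + (u + 1))) 1 a
      (p ^ (k + (u + 1)) - p ^ (u + 1) + i) : Set (Fin (1 * p ^ (k + (u + 1))) → F)) =
      2 * (θ + 2) * p ^ k := by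
  refine minPairDist_binomialCode_two_mul p one_pos ha k u θ i hθp hi' fun G hG hdeg hdvd => ?_
  rw [one_mul] at hdeg ⊢
  rw [pow_one] at hdvd
  exact two_mul_le_card_pairSupport_of_one_le p ha hu hθ hθp hG hdeg
    ((pow_dvd_pow _ hi).trans hdvd)

theorem minPairDist_binomialCode_one_of_le (p : ℕ) [hp : Fact p.Prime] [CharP F p]
    {a : F} (ha : a ≠ 0) (k u i : ℕ) (hu : 1 ≤ u) (hi : 2 ≤ i) (hi' : i ≤ p ^ u) :
    minPairDist (binomialCode (1 * p ^ (k + (u + 1))) (a ^ p ^ (k + (u + 1))) 1 a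
      (p ^ (k + (u + 1)) - p ^ (u + 1) + i) : Set (Fin (1 * p ^ (k + (u + 1))) → F)) =
      4 * p ^ k := by
  refine minPairDist_binomialCode_two_mul p one_pos ha k u 0 i hp.out.two_le (by simpa using hi')
    fun G hG hdeg hdvd => ?_
  rw [one_mul] at hdeg ⊢
  rw [pow_one] at hdvd
  exact four_le_card_pairSupport p ha hu hG hdeg ((pow_dvd_pow _ hi).trans hdvd)

theorem minPairDist_binomialCode_one_one (p : ℕ) [hp : Fact p.Prime] [CharP F p]
    {a : F} (ha : a ≠ 0) (k u : ℕ) (hu : 1 ≤ u) :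
    minPairDist (binomialCode (1 * p ^ (k + (u + 1))) (a ^ p ^ (k + (u + 1))) 1 a
      (p ^ (k + (u + 1)) - p ^ (u + 1) + 1) : Set (Fin (1 * p ^ (k + (u + 1))) → F)) =
      3 * p ^ k := by
  have h4 : 4 ≤ 1 * p ^ (u + 1) := by
    rw [one_mul]
    calc 4 = 2 ^ 2 := rfl
      _ ≤ p ^ 2 := Nat.pow_le_pow_left hp.out.two_le 2
      _ ≤ p ^ (u + 1) := Nat.pow_le_pow_right hp.out.pos (by omega)
  rw [mul_comm _ (p ^ k)]
  refine minPairDist_binomialCode p one_pos ha k (u + 1) 1 _ (by omega)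
    (fun G hG hdeg hdvd => ?_) ⟨X - C a, X_sub_C_ne_zero a, ?_, by simp, ?_⟩
  · rw [pow_one, pow_one] at hdvd
    exact min_le_card_pairSupport (support_subset_range hdeg) (nonempty_support_iff.2 hG)
      (by omega) (one_lt_card_support ha hG hdvd)
  · rw [natDegree_X_sub_C]
    omega
  · exact card_pairSupport_le_of_subset_range
      (support_subset_range (by rw [natDegree_X_sub_C]; exact one_lt_two))

/-- The reduced length is `p`, which caps the pair weight; the cap is active only for `θ = p - 1`.
-/
theorem minPairDist_binomialCode_one_of_lt (p : ℕ) [hp : Fact p.Prime] [CharP F p]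
    {a : F} (ha : a ≠ 0) (k θ : ℕ) (hθ : θ + 1 ≤ p) :
    minPairDist (binomialCode (1 * p ^ (k + 1)) (a ^ p ^ (k + 1)) 1 a
      (p ^ (k + 1) - p ^ 1 + θ) : Set (Fin (1 * p ^ (k + 1)) → F)) =
      p ^ k * min (θ + 2) p := by
  have hdeg0 : ((X - C a) ^ θ).natDegree = θ := by
    rw [natDegree_pow, natDegree_X_sub_C, mul_one]
  refine minPairDist_binomialCode p one_pos ha k 1 θ _ (by rw [pow_one]; omega) (fun G hG hdeg hdvd => ?_)
    ⟨(X - C a) ^ θ, pow_ne_zero _ (X_sub_C_ne_zero a), ?_, by simp, ?_⟩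
  · have hS := support_subset_range hdeg
    rw [one_mul, pow_one] at hdeg hS ⊢
    rw [pow_one] at hdvd
    have hw := lt_card_support_of_natDegree_lt p ha hG hdeg hdvd
    rcases Nat.lt_or_ge p (θ + 2) with h | h
    · have := card_le_card_pairSupport hS
      omega
    · have := min_le_card_pairSupport hS (nonempty_support_iff.2 hG) h hw
      omega
  · rw [pow_one, hdeg0, one_mul]
    exact hθ
  · apply le_min
    · exact card_pairSupport_le_of_subset_range (support_subset_range (by rw [hdeg0]; omega))
    · exact (card_pairSupport_le _ _).trans (by simp)

/-- The block is read off from the leading base-`p` digit `v` of `p^s - i` and its position `t`: `k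
= s - 1 - t`, `θ = p - 1 - v`. -/
theorem exists_block_index {p s i : ℕ} (hp : 2 ≤ p) (h1 : 1 ≤ i) (h2 : i ≤ p ^ s - 1) :
    ∃ k θ, k + 1 ≤ s ∧ θ + 2 ≤ p ∧
      p ^ s - p ^ (s - k) + θ * p ^ (s - k - 1) + 1 ≤ i ∧
      i ≤ p ^ s - p ^ (s - k) + (θ + 1) * p ^ (s - k - 1) := by
  have hj0 : p ^ s - i ≠ 0 := by omega
  obtain ⟨j, hj⟩ : ∃ j, j = p ^ s - i := ⟨_, rfl⟩
  rw [← hj] at hj0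
  have hlo := Nat.pow_log_le_self p hj0
  have hhi := Nat.lt_pow_succ_log_self (b := p) (by omega) j
  obtain ⟨t, ht⟩ : ∃ t, t = Nat.log p j := ⟨_, rfl⟩
  rw [← ht] at hlo hhi
  have hts : t < s := (Nat.pow_lt_pow_iff_right (by omega : 1 < p)).1 (by omega)
  have hle : p ^ (t + 1) ≤ p ^ s := Nat.pow_le_pow_right (by omega) hts
  have hpt : 0 < p ^ t := pow_pos (by omega) t
  obtain ⟨v, hv⟩ : ∃ v, v = j / p ^ t := ⟨_, rfl⟩
  have hv1 : 1 ≤ v := by rw [hv]; exact (Nat.one_le_div_iff hpt).2 hlo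
  have hvp : v < p := by
    rw [hv, Nat.div_lt_iff_lt_mul hpt, mul_comm, ← pow_succ]
    exact hhi
  have hv2 : v * p ^ t ≤ j := by rw [hv]; exact Nat.div_mul_le_self _ _
  have hv3 : j < (v + 1) * p ^ t := by
    rw [hv, Nat.add_one_mul]; exact Nat.lt_div_mul_add hpt
  refine ⟨s - 1 - t, p - 1 - v, by omega, by omega, ?_⟩
  rw [show s - (s - 1 - t) = t + 1 by omega, Nat.add_sub_cancel]
  have e1 : (p - 1 - v) * p ^ t + (v + 1) * p ^ t = p ^ (t + 1) := by
    rw [← Nat.add_mul, show p - 1 - v + (v + 1) = p by omega, pow_succ, mul_comm]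
  have e2 : (p - 1 - v + 1) * p ^ t + v * p ^ t = p ^ (t + 1) := by
    rw [← Nat.add_mul, show p - 1 - v + 1 + v = p by omega, pow_succ, mul_comm]
  omega

theorem exists_eq_block_add {p s k i : ℕ} (hk : k + 1 ≤ s)
    (hi : p ^ s - p ^ (s - k) ≤ i) :
    ∃ u j, s = k + (u + 1) ∧ i = p ^ (k + (u + 1)) - p ^ (u + 1) + j := by
  refine ⟨s - k - 1, i - (p ^ s - p ^ (s - k)), by omega, ?_⟩
  rw [show k + (s - k - 1 + 1) = s by omega, show s - k - 1 + 1 = s - k by omega]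
  omega

end SymbolPair

/-! ### Assembly of the cases. -/

theorem mainTheorem1 {F : Type*} [Field F] [Fintype F] [DecidableEq F]
    (p m s n : ℕ) (hp : p.Prime) (hF : Fintype.card F = p ^ m) (hN : 2 ≤ n * p ^ s)
    (α₀ α : F) (hα₀ : α₀ ≠ 0) (hα : α = α₀ ^ p ^ s)
    (d : ℕ → ℕ)
    (hd : ∀ i, d i =
      SymbolPair.minPairDist (SymbolPair.binomialCode (n * p ^ s) α n α₀ i : Set (Fin (n * p ^ s) → F))) :
    -- (i) the trivial cases
    (d 0 = 2 ∧ d (p ^ s) = 0) ∧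
    -- (ii) the case `n = 1`
    (n = 1 →
      (∀ i k, k + 2 ≤ s → i = p ^ s - p ^ (s - k) + 1 → d i = 3 * p ^ k) ∧
      (∀ i k, k + 2 ≤ s → p ^ s - p ^ (s - k) + 2 ≤ i →
        i ≤ p ^ s - p ^ (s - k) + p ^ (s - k - 1) → d i = 4 * p ^ k) ∧
      (∀ i k θ, k + 2 ≤ s → 1 ≤ θ → θ + 2 ≤ p →
        p ^ s - p ^ (s - k) + θ * p ^ (s - k - 1) + 1 ≤ i →
        i ≤ p ^ s - p ^ (s - k) + (θ + 1) * p ^ (s - k - 1) → d i = 2 * (θ + 2) * p ^ k) ∧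
      (∀ i θ, 1 ≤ θ → θ + 2 ≤ p → i = p ^ s - p + θ → d i = (θ + 2) * p ^ (s - 1)) ∧
      (∀ i, i = p ^ s - 1 → d i = p ^ s) ∧
      -- these cases exhaust `1 ≤ i ≤ p ^ s - 1`
      (∀ i, 1 ≤ i → i ≤ p ^ s - 1 →
        (∃ k, k + 2 ≤ s ∧ i = p ^ s - p ^ (s - k) + 1) ∨
        (∃ k, k + 2 ≤ s ∧ p ^ s - p ^ (s - k) + 2 ≤ i ∧
          i ≤ p ^ s - p ^ (s - k) + p ^ (s - k - 1)) ∨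
        (∃ k θ, k + 2 ≤ s ∧ 1 ≤ θ ∧ θ + 2 ≤ p ∧
          p ^ s - p ^ (s - k) + θ * p ^ (s - k - 1) + 1 ≤ i ∧
          i ≤ p ^ s - p ^ (s - k) + (θ + 1) * p ^ (s - k - 1)) ∨
        (∃ θ, 1 ≤ θ ∧ θ + 2 ≤ p ∧ i = p ^ s - p + θ) ∨
        i = p ^ s - 1)) ∧
    -- (iii) the case `n ≥ 2`
    (2 ≤ n →
      (∀ i k θ, k + 1 ≤ s → θ + 2 ≤ p →
        p ^ s - p ^ (s - k) + θ * p ^ (s - k - 1) + 1 ≤ i →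
        i ≤ p ^ s - p ^ (s - k) + (θ + 1) * p ^ (s - k - 1) → d i = 2 * (θ + 2) * p ^ k) ∧
      -- these cases exhaust `1 ≤ i ≤ p ^ s - 1`
      (∀ i, 1 ≤ i → i ≤ p ^ s - 1 →
        ∃ k θ, k + 1 ≤ s ∧ θ + 2 ≤ p ∧
          p ^ s - p ^ (s - k) + θ * p ^ (s - k - 1) + 1 ≤ i ∧
          i ≤ p ^ s - p ^ (s - k) + (θ + 1) * p ^ (s - k - 1))) := by
  have hpf : Fact p.Prime := ⟨hp⟩
  have : CharP F p := charP_of_card_eq_prime_pow hF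
  have hp2 := hp.two_le
  have hn0 : 0 < n := Nat.pos_of_mul_pos_right (by omega : 0 < n * p ^ s)
  subst hα
  refine ⟨⟨?_, ?_⟩, ?_, ?_⟩
  · rw [hd]
    exact SymbolPair.minPairDist_binomialCode_zero p hN hα₀
  · rw [hd]
    exact SymbolPair.minPairDist_binomialCode_top p hn0 s α₀
  · rintro rfl
    have hs : 1 ≤ s := by
      by_contra h
      rw [show s = 0 by omega] at hN
      simp at hN
    refine ⟨?_, ?_, ?_, ?_, ?_, ?_⟩
    · intro i k hk hi
      obtain ⟨u, j, rfl, rfl⟩ := SymbolPair.exists_eq_block_add (by omega : k + 1 ≤ s)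
        (by omega : p ^ s - p ^ (s - k) ≤ i)
      rw [Nat.add_sub_cancel_left] at hi
      obtain rfl : j = 1 := by omega
      rw [hd]
      exact SymbolPair.minPairDist_binomialCode_one_one p hα₀ k u (by omega)
    · intro i k hk hi hi'
      obtain ⟨u, j, rfl, rfl⟩ := SymbolPair.exists_eq_block_add (by omega : k + 1 ≤ s)
        (by omega : p ^ s - p ^ (s - k) ≤ i)
      rw [Nat.add_sub_cancel_left] at hi hi'
      rw [Nat.add_sub_cancel] at hi'
      rw [hd]
      exact SymbolPair.minPairDist_binomialCode_one_of_le p hα₀ k u j (by omega) (by omega)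
        (by omega)
    · intro i k θ hk hθ hθp hi hi'
      obtain ⟨u, j, rfl, rfl⟩ := SymbolPair.exists_eq_block_add (by omega : k + 1 ≤ s)
        (by omega : p ^ s - p ^ (s - k) ≤ i)
      rw [Nat.add_sub_cancel_left, Nat.add_sub_cancel] at hi hi'
      rw [hd]
      exact SymbolPair.minPairDist_binomialCode_one p hα₀ k u θ j (by omega) hθ hθp (by omega)
        (by omega)
    · rintro i θ hθ hθp rfl
      obtain ⟨k, rfl⟩ := Nat.exists_eq_add_of_le' hs
      have h := SymbolPair.minPairDist_binomialCode_one_of_lt p hα₀ k θ (by omega)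
      rw [pow_one, min_eq_left hθp, mul_comm (p ^ k)] at h
      rw [hd]
      exact h
    · rintro i rfl
      obtain ⟨k, rfl⟩ := Nat.exists_eq_add_of_le' hs
      have h := SymbolPair.minPairDist_binomialCode_one_of_lt p hα₀ k (p - 1) (by omega)
      have hple : p ≤ p ^ (k + 1) := Nat.le_self_pow (Nat.succ_ne_zero k) p
      rw [pow_one, min_eq_right (by omega), ← pow_succ,
        show p ^ (k + 1) - p + (p - 1) = p ^ (k + 1) - 1 by omega] at h
      rw [hd]
      exact h
    · intro i h1 h2
      obtain ⟨k, θ, hk, hθ, hi, hi'⟩ := SymbolPair.exists_block_index hp2 h1 h2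
      rcases Nat.lt_or_ge (k + 1) s with hks | hks
      · rcases Nat.eq_zero_or_pos θ with rfl | hθ0
        · rw [Nat.zero_mul] at hi
          rw [Nat.zero_add, Nat.one_mul] at hi'
          rcases Nat.lt_or_ge (p ^ s - p ^ (s - k) + 1) i with h | h
          · exact Or.inr (Or.inl ⟨k, hks, h, hi'⟩)
          · exact Or.inl ⟨k, hks, by omega⟩
        · exact Or.inr (Or.inr (Or.inl ⟨k, θ, hks, hθ0, hθ, hi, hi'⟩))
      · have hple : p ≤ p ^ s := Nat.le_self_pow (by omega) p
        rw [show s - k = 1 by omega, Nat.sub_self, pow_zero, pow_one, mul_one] at hi hi'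
        -- Here `k = s - 1` and the block is the single point `i = p^s - p + θ + 1`, so the index in
        -- the statement is `θ + 1`, unless `θ + 2 = p`.
        rcases Nat.lt_or_ge p (θ + 3) with h | h
        · exact Or.inr (Or.inr (Or.inr (Or.inr (by omega))))
        · exact Or.inr (Or.inr (Or.inr (Or.inl ⟨θ + 1, by omega, by omega, by omega⟩)))
  · intro hn
    refine ⟨?_, fun i h1 h2 => SymbolPair.exists_block_index hp2 h1 h2⟩
    intro i k θ hk hθp hi hi'
    obtain ⟨u, j, rfl, rfl⟩ := SymbolPair.exists_eq_block_add hk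
      (by omega : p ^ s - p ^ (s - k) ≤ i)
    rw [Nat.add_sub_cancel_left, Nat.add_sub_cancel] at hi hi'
    rw [hd]
    exact SymbolPair.minPairDist_binomialCode_of_two_le p hn hα₀ k u θ j hθp (by omega)
      (by omega)
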